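/- Conventions. A $G$-function is a formal power series $f(z)=\sum_{n\ge0}a_nz^n$ with algebraic coefficients $a_n\in\overline{\mathbb Q}\subset\mathbb C$ such that (a) there is a $C>0$ for which, for all $n\ge0$, every conjugate of $a_n$ over $\mathbb Q$ has modulus at most $C^{n+1}$, and there are nonzero integers $d_n$ with $|d_n|\le C^{n+1}$ such that $d_na_m$ is an algebraic integer for all $m\le n$; and (b) $f$ satisfies a nontrivial homogeneous linear differential equation with coefficients in $\overline{\mathbb Q}(z)$. For a subfield $\mathbb K\subset\overline{\mathbb Q}$ and a real $R\ge1$, let $\mathbf G^{\mathrm{a.c.}}_{R,\mathbb K}$ be the set of all values $f(1)$ of $G$-functions $f$ with Taylor coefficients in $\mathbb K$ and radius of convergence $>R$, and let $\mathbf G^{\mathrm{a.c.}}_{\mathbb K}=\bigcap_{R\ge1}\mathbf G^{\mathrm{a.c.}}_{R,\mathbb K}$. Lemma. Let $\alpha\in\overline{\mathbb Q}$, and let $Q\in\mathbb Q[X]$ be a nonzero polynomial of which $\alpha$ is a simple root. (1) For every $u\in\mathbb Q(i)$ with $Q'(u)\ne0$, the formal power series $$\Phi_u(z)=u+\sum_{n=1}^\infty(-1)^n\frac{Q(u)^n}{n!}\,\frac{\partial^{n-1}}{\partial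 x^{n-1}}\left(\Big(\frac{x-u}{Q(x)-Q(u)}\Big)^n\right)_{|x=u}z^n$$ (where $\frac{x-u}{Q(x)-Q(u)}$ is given its limit $1/Q'(u)$ at $x=u$) is a $G$-function with coefficients in $\mathbb Q(i)$, and it satisfies $Q(\Phi_u(z))=(1-z)\,Q(u)$ as an identity of formal power series. (2) For every real $R\ge1$ there is an $\varepsilon>0$ such that every $u\in\mathbb Q(i)$ with $|u-\alpha|<\varepsilon$ satisfies $Q'(u)\ne0$, the radius of convergence of $\Phi_u$ is $>R$, and $\alpha=\Phi_u(1)\in\mathbf G^{\mathrm{a.c.}}_{R,\mathbb Q(i)}$. Consequently $\overline{\mathbb Q}\subset\mathbf G^{\mathrm{a.c.}}_{\mathbb Q(i)}$: every algebraic number is, for each $R\ge1$, the value at $1$ of a $G$-function with coefficients in $\mathbb Q(i)$ and radius of convergence $>R$. -/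

import Mathlib

open Polynomial

noncomputable section

/-- The field `ℚ(i)`, as a subfield of `ℂ`. -/
def GaussField : IntermediateField ℚ ℂ := IntermediateField.adjoin ℚ {Complex.I}

/-- The formal power series `f` satisfies a nontrivial homogeneous linear differential equation
`p₀ f + p₁ f' + ⋯ + p_r f⁽ʳ⁾ = 0`, `p_r ≠ 0`, with coefficients in `ℚ̄[z]`
(equivalently, after clearing denominators, in `ℚ̄(z)`). -/
def SatisfiesLinearODE (f : PowerSeries ℂ) : Prop :=
  ∃ (r : ℕ) (p : ℕ → ℂ[X]),
    (∀ j k, IsAlgebraic ℚ ((p j).coeff k)) ∧ p r ≠ 0 ∧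
      ∑ j ∈ Finset.range (r + 1),
        (p j : PowerSeries ℂ) * (PowerSeries.derivative ℂ)^[j] f = 0

/-- `G`-functions. The bounds are written `C ^ (n + 1)`, so that they constrain `a₀` only up to
the choice of `C` (with `C ^ n` a nonzero constant would have to be an algebraic integer all of
whose conjugates have modulus at most one). -/
structure IsGFunction (f : PowerSeries ℂ) : Prop where
  /-- The coefficients are algebraic numbers. -/
  algebraic : ∀ n, IsAlgebraic ℚ (PowerSeries.coeff n f)
  /-- All conjugates of the coefficients, and suitable common denominators of
  `a₀, …, aₙ`, grow at most geometrically. -/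
  growth : ∃ C : ℝ, 0 < C ∧
    (∀ n (b : ℂ), IsConjRoot ℚ (PowerSeries.coeff n f) b → ‖b‖ ≤ C ^ (n + 1)) ∧
    ∃ d : ℕ → ℤ, ∀ n, d n ≠ 0 ∧ |(d n : ℝ)| ≤ C ^ (n + 1) ∧
      ∀ m ≤ n, IsIntegral ℤ ((d n : ℂ) * PowerSeries.coeff m f)
  /-- A linear differential equation over `ℚ̄(z)`. -/
  ode : SatisfiesLinearODE f

/-- The Taylor coefficients of `f` all lie in `K`. -/
def HasCoeffsIn (K : IntermediateField ℚ ℂ) (f : PowerSeries ℂ) : Prop :=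
  ∀ n, PowerSeries.coeff n f ∈ K

/-- The radius of convergence of the power series `∑ aₙ zⁿ`, in `[0, ∞]`. -/
def convergenceRadius (f : PowerSeries ℂ) : ENNReal :=
  (FormalMultilinearSeries.ofScalars ℂ (fun n => PowerSeries.coeff n f)).radius

/-- `f(z) = w`: the series `∑ aₙ zⁿ` converges, with sum `w`. -/
def HasValueAt (f : PowerSeries ℂ) (z w : ℂ) : Prop :=
  HasSum (fun n => PowerSeries.coeff n f * z ^ n) w

/-- The set of values `f(1)` of `G`-functions `f` with Taylor coefficients in `K` and radius of
convergence `> R`. -/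
def GValuesOfRadius (R : ℝ) (K : IntermediateField ℚ ℂ) : Set ℂ :=
  {w | ∃ f : PowerSeries ℂ, IsGFunction f ∧ HasCoeffsIn K f ∧
    ENNReal.ofReal R < convergenceRadius f ∧ HasValueAt f 1 w}

/-- The set of numbers that, for every `R ≥ 1`, are the value `f(1)` of a `G`-function `f` with
Taylor coefficients in `K` and radius of convergence `> R`. -/
def GValues (K : IntermediateField ℚ ℂ) : Set ℂ :=
  {w | ∀ R : ℝ, 1 ≤ R → w ∈ GValuesOfRadius R K}

/-- The function `x ↦ (x - u) / (Q(x) - Q(u))`, with its removable singularity at `x = u` filled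
in by the limit `1 / Q'(u)`. -/
def lagrangeKernel (Q : ℚ[X]) (u x : ℂ) : ℂ :=
  if x = u then (aeval u (derivative Q))⁻¹ else (x - u) / (aeval x Q - aeval u Q)

/-- The kernel is the inverse of the difference quotient of `Q` at `u`. -/
theorem lagrangeKernel_eq_inv_dslope (Q : ℚ[X]) (u x : ℂ) :
    lagrangeKernel Q u x = (dslope (fun y : ℂ => aeval y Q) u x)⁻¹ := by
  unfold lagrangeKernel
  split_ifs with h
  · subst h
    rw [dslope_same, Polynomial.deriv_aeval]
  · rw [dslope_of_ne _ h, slope_def_field, inv_div]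

/-- The series `Φ_u(z) = u + ∑_{n ≥ 1} (-1)ⁿ (Q(u)ⁿ / n!) ∂ₓⁿ⁻¹ [((x-u)/(Q(x)-Q(u)))ⁿ]_{x=u} zⁿ`. -/
def lagrangeSeries (Q : ℚ[X]) (u : ℂ) : PowerSeries ℂ :=
  PowerSeries.mk fun n =>
    if n = 0 then u
    else (-1) ^ n * ((aeval u Q) ^ n / (n.factorial : ℂ)) *
      iteratedDeriv (n - 1) (fun x : ℂ => lagrangeKernel Q u x ^ n) u

end

/-! Put `w(t) = Q(u + t) - Q(u)`. Since `w(0) = 0` and `w'(0) = Q'(u) ≠ 0`, `w` has a compositional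
inverse `ψ`. The kernel has Taylor series `t / w(t)` in `t = x - u`, so Lagrange inversion
(`coeff_of_subst_eq_X`) gives `Φ_u(z) = u + ψ(-Q(u) z)` (`lagrangeSeries_eq_rescale`), and `w(ψ) =
z` becomes `Q(Φ_u) = (1 - z) Q(u)`.

`Φ_u` is a `G`-function for three reasons. Conjugation over `ℚ` preserves the modulus on `ℚ(i)`, so
Cauchy's estimate bounds all conjugates. A rescaling turns `w` into `t + O(t²)` with integral
coefficients, whose inverse is again integral, so denominators grow geometrically. Finally `Φ_u` is
integral over `K[z]`, where `K = ℚ(i)`, and some `D ≠ 0` in `K[z]` makes `D · d/dz` preserve the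
finite `K[z]`-module `K[z][Φ_u]`; the elements `D^j Φ_u⁽ʲ⁾` are therefore linearly dependent.

Near a simple root `α`, `exists_lagrangeKernel_bound` gives a disc radius `ρ` and a kernel bound `B`
independent of `u`. The coefficients are then `O(qⁿ)` with `q = |Q(u)| B / ρ`, which tends to `0` as
`u → α`. The value at `1` is a root of `Q` within `ρ` of `u`, and `Q` is injective on that disc, so
it is `α`. The last claim follows from separability of minimal polynomials and density of `ℚ(i)`. -/

namespace PowerSeries

/-! ### Formal Lagrange inversion -/

variable {K : Type*} [Field K] [CharZero K]

/-- The coefficient of `X ^ m` in `G ^ (m + 1) * w'`, for `G = X / w`: a formal residue. -/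
theorem coeff_pow_mul_derivative_of_mul_eq_X {w G : K⟦X⟧} (hw : constantCoeff w = 0) (hwG : w * G = X) (m : ℕ) :
    coeff m (G ^ (m + 1) * derivative K w) = if m = 0 then 1 else 0 := by
  have hd : derivative K w * G + w * derivative K G = 1 := by
    have h := congrArg (derivative K) hwG
    rw [Derivation.leibniz, derivative_X, smul_eq_mul, smul_eq_mul] at h
    rw [← h]; ring
  cases m with
  | zero =>
    have h1 := congrArg constantCoeff hd
    simp only [map_add, map_mul, hw, zero_mul, add_zero, map_one] at h1
    rw [if_pos rfl, coeff_zero_eq_constantCoeff_apply, map_mul, zero_add, pow_one, mul_comm, h1]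
  | succ m =>
    -- With `k = m + 1`, the right side is `G^k - X (G^k)' / k`, whose coefficient of `X^k` cancels;
    -- characteristic zero permits the division.
    have h1 : G ^ (m + 2) * derivative K w = G ^ (m + 1) - X * (G ^ m * derivative K G) := by
      rw [← hwG]
      linear_combination G ^ (m + 1) * hd
    have h2 := congrArg (coeff m) (derivative_pow G (m + 1))
    rw [coeff_derivative, Nat.add_sub_cancel, mul_assoc, ← map_natCast (C (R := K)), coeff_C_mul]
      at h2
    rw [h1, map_sub, coeff_succ_X_mul]
    have h3 : ((m : K) + 1) ≠ 0 := by exact_mod_cast Nat.succ_ne_zero m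
    have h4 : coeff (m + 1) (G ^ (m + 1)) = coeff m (G ^ m * derivative K G) := by
      apply mul_left_cancel₀ h3
      push_cast at h2
      linear_combination h2
    simp [h4]

/-- **Lagrange inversion**: the coefficients of the compositional inverse `ψ` of `w`. -/
theorem coeff_of_subst_eq_X {w G ψ : K⟦X⟧} (hw : constantCoeff w = 0) (hwG : w * G = X)
    (hψ : ψ.subst w = X) (n : ℕ) :
    ((n : K) + 1) * coeff (n + 1) ψ = coeff n (G ^ (n + 1)) := by
  have hs : HasSubst w := HasSubst.of_constantCoeff_zero' hw
  have h1 : (derivative K ψ).subst w * derivative K w = 1 := by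
    rw [← derivative_subst hs, hψ, derivative_X]
  set p := derivative K ψ with hp
  -- Only the first `n + 1` terms of `p` matter: the tail of `p(w)` carries `w^(n+1)`, which
  -- `G^(n+1)` turns into `X^(n+1)`.
  obtain ⟨r, hr⟩ : X ^ (n + 1) ∣ p - (trunc (n + 1) p : K⟦X⟧) := by
    rw [X_pow_dvd_iff]
    intro m hm
    rw [map_sub, coeff_coe_trunc_of_lt hm, sub_self]
  have h2 : p.subst w = ∑ k ∈ Finset.range (n + 1), C (coeff k p) * w ^ k
      + w ^ (n + 1) * r.subst w := by
    have : p = (trunc (n + 1) p : K⟦X⟧) + X ^ (n + 1) * r := by rw [← hr]; ring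
    conv_lhs => rw [this]
    rw [subst_add hs, subst_mul hs, subst_pow hs, subst_X hs, subst_coe hs]
    congr 1
    rw [Polynomial.aeval_eq_sum_range' (natDegree_trunc_lt p n)]
    refine Finset.sum_congr rfl fun k hk => ?_
    rw [coeff_trunc, if_pos (Finset.mem_range.1 hk), smul_eq_C_mul]
  -- Insert `1 = p(w) w'`. Each summand becomes `X^k` times a formal residue, and only `k = n`
  -- contributes.
  have h3 : G ^ (n + 1) = ∑ k ∈ Finset.range (n + 1), C (coeff k p) * (w ^ k * G ^ (n + 1) *
      derivative K w) + X ^ (n + 1) * (r.subst w * derivative K w) := by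
    calc G ^ (n + 1) = G ^ (n + 1) * (p.subst w * derivative K w) := by rw [h1, mul_one]
      _ = _ := by
        rw [h2, ← hwG, add_mul, mul_add, Finset.sum_mul, Finset.mul_sum, mul_pow]
        congr 1
        · exact Finset.sum_congr rfl fun k _ => by ring
        · ring
  rw [h3, map_add, map_sum, coeff_X_pow_mul', if_neg (by lia), add_zero,
    Finset.sum_eq_single_of_mem n (by simp)]
  · have h4 : w ^ n * G ^ (n + 1) * derivative K w = X ^ n * (G ^ (0 + 1) * derivative K w) := by
      rw [← hwG]; ring
    rw [coeff_C_mul, h4, coeff_X_pow_mul', if_pos le_rfl, Nat.sub_self,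
      coeff_pow_mul_derivative_of_mul_eq_X hw hwG, if_pos rfl, hp, coeff_derivative]
    ring
  · intro k hk hkn
    obtain ⟨m, rfl⟩ : ∃ m, n = k + (m + 1) := ⟨n - k - 1, by
      have := Finset.mem_range.1 hk; lia⟩
    have h4 : w ^ k * G ^ (k + (m + 1) + 1) * derivative K w
        = X ^ k * (G ^ (m + 1 + 1) * derivative K w) := by
      rw [← hwG]; ring
    rw [coeff_C_mul, h4, coeff_X_pow_mul', if_pos (by lia), Nat.add_sub_cancel_left,
      coeff_pow_mul_derivative_of_mul_eq_X hw hwG, if_neg (by lia), mul_zero]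

end PowerSeries

/-! ### Taylor series of the kernel -/

/-- The formal Taylor series of `f` at `u`. -/
noncomputable def taylorSeries (f : ℂ → ℂ) (u : ℂ) : PowerSeries ℂ :=
  PowerSeries.mk fun n => iteratedDeriv n f u / (n.factorial : ℂ)

theorem taylorSeries_mul {f g : ℂ → ℂ} {u : ℂ} (hf : AnalyticAt ℂ f u) (hg : AnalyticAt ℂ g u) :
    taylorSeries (f * g) u = taylorSeries f u * taylorSeries g u := by
  ext n
  simp only [taylorSeries, PowerSeries.coeff_mk, iteratedDeriv_mul hf.contDiffAt hg.contDiffAt,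
    PowerSeries.coeff_mul, Finset.Nat.sum_antidiagonal_eq_sum_range_succ_mk, Nat.succ_eq_add_one,
    Finset.sum_div]
  refine Finset.sum_congr rfl fun i hi => ?_
  rw [Nat.cast_choose _ (by grind)]
  field_simp [Nat.factorial_ne_zero]

theorem taylorSeries_add {f g : ℂ → ℂ} {u : ℂ} (hf : AnalyticAt ℂ f u) (hg : AnalyticAt ℂ g u) :
    taylorSeries (f + g) u = taylorSeries f u + taylorSeries g u := by
  ext n
  simp [taylorSeries, iteratedDeriv_add hf.contDiffAt hg.contDiffAt, add_div]

theorem taylorSeries_const (c u : ℂ) : taylorSeries (fun _ => c) u = PowerSeries.C c := by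
  ext n
  rw [taylorSeries, PowerSeries.coeff_mk, iteratedDeriv_const, PowerSeries.coeff_C]
  split_ifs with h <;> simp [h]

theorem analyticAt_id_fun (u : ℂ) : AnalyticAt ℂ (fun x : ℂ => x) u := analyticAt_id

theorem taylorSeries_id (u : ℂ) :
    taylorSeries (fun x => x) u = PowerSeries.X + PowerSeries.C u := by
  ext n
  rw [taylorSeries, PowerSeries.coeff_mk, map_add, PowerSeries.coeff_X, PowerSeries.coeff_C]
  match n with
  | 0 => simp
  | 1 => simp [iteratedDeriv_one]
  | n + 2 =>
    have h : iteratedDeriv 1 (fun x : ℂ => x) = fun _ => 1 := by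
      ext x; simp [iteratedDeriv_one]
    have h2 : iteratedDeriv (n + 2) (fun x : ℂ => x) u = 0 := by
      rw [show n + 2 = (n + 1) + 1 by rfl, iteratedDeriv_succ']
      simp [iteratedDeriv_const]
    simp [h2]

theorem taylorSeries_pow {f : ℂ → ℂ} {u : ℂ} (hf : AnalyticAt ℂ f u) (n : ℕ) :
    taylorSeries (fun x => f x ^ n) u = taylorSeries f u ^ n := by
  induction n with
  | zero => simp [taylorSeries_const]
  | succ n ih =>
    rw [pow_succ, ← ih, ← taylorSeries_mul (hf.fun_pow n) hf]
    rfl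

theorem analyticAt_aeval (Q : ℚ[X]) (u : ℂ) : AnalyticAt ℂ (fun x : ℂ => aeval x Q) u :=
  analyticAt_id.aeval_polynomial Q

theorem taylorSeries_aeval (Q : ℚ[X]) (u : ℂ) :
    taylorSeries (fun x => aeval x Q) u = aeval (PowerSeries.X + PowerSeries.C u) Q := by
  induction Q using Polynomial.induction_on' with
  | add p q hp hq =>
    rw [map_add, ← hp, ← hq, ← taylorSeries_add (analyticAt_aeval p u) (analyticAt_aeval q u)]
    congr 1
    ext x
    simp
  | monomial n a =>
    have h1 : (fun x : ℂ => aeval x (monomial n a)) = (fun _ => (a : ℂ)) * (fun x => x ^ n) := by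
      ext x
      simp [aeval_monomial]
    rw [h1, taylorSeries_mul analyticAt_const (analyticAt_id_fun u |>.fun_pow n), taylorSeries_const,
      taylorSeries_pow (analyticAt_id_fun u), taylorSeries_id, aeval_monomial]
    congr 1
    exact RingHom.congr_fun (RingHom.ext_rat ((PowerSeries.C (R := ℂ)).comp (algebraMap ℚ ℂ))
      (algebraMap ℚ (PowerSeries ℂ))) a

theorem differentiable_dslope_aeval (Q : ℚ[X]) (u : ℂ) :
    Differentiable ℂ (dslope (fun y : ℂ => aeval y Q) u) := by
  rw [← differentiableOn_univ, Complex.differentiableOn_dslope Filter.univ_mem]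
  exact (Polynomial.differentiable_aeval Q).differentiableOn

theorem dslope_aeval_same (Q : ℚ[X]) (u : ℂ) :
    dslope (fun y : ℂ => aeval y Q) u u = aeval u (derivative Q) := by
  rw [dslope_same, Polynomial.deriv_aeval]

theorem lagrangeKernel_eq_inv (Q : ℚ[X]) (u : ℂ) :
    lagrangeKernel Q u = (dslope (fun y : ℂ => aeval y Q) u)⁻¹ :=
  funext fun x => lagrangeKernel_eq_inv_dslope Q u x

theorem analyticAt_lagrangeKernel {Q : ℚ[X]} {u : ℂ} (hu : aeval u (derivative Q) ≠ 0) :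
    AnalyticAt ℂ (lagrangeKernel Q u) u := by
  rw [lagrangeKernel_eq_inv]
  exact ((differentiable_dslope_aeval Q u).analyticAt u).inv (by rwa [dslope_aeval_same])

/-- The polynomial `Q(u + t) - Q(u)` in `t`, as a power series. -/
noncomputable def shiftSeries (Q : ℚ[X]) (u : ℂ) : PowerSeries ℂ :=
  aeval (PowerSeries.X + PowerSeries.C u) Q - PowerSeries.C (aeval u Q)

theorem shiftSeries_mul_taylorSeries {Q : ℚ[X]} {u : ℂ} (hu : aeval u (derivative Q) ≠ 0) :
    shiftSeries Q u * taylorSeries (lagrangeKernel Q u) u = PowerSeries.X := by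
  set D := dslope (fun y : ℂ => aeval y Q) u with hD
  have hDa : AnalyticAt ℂ D u := (differentiable_dslope_aeval Q u).analyticAt u
  -- The relation `(x - u) D(x) = Q(x) - Q(u)`, rearranged without subtraction so that additivity
  -- and multiplicativity of Taylor series suffice.
  have h1 : (fun x : ℂ => x) * D + (fun _ => aeval u Q)
      = (fun x : ℂ => aeval x Q) + (fun _ => u) * D := by
    ext x
    have := sub_smul_dslope (fun y : ℂ => aeval y Q) u x
    simp only [smul_eq_mul] at this
    simp only [Pi.add_apply, Pi.mul_apply]
    linear_combination this
  have h2 := congrArg (taylorSeries · u) h1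
  beta_reduce at h2
  rw [taylorSeries_add ((analyticAt_id_fun u).mul hDa) analyticAt_const,
    taylorSeries_add (analyticAt_aeval Q u) (analyticAt_const.mul hDa),
    taylorSeries_mul (analyticAt_id_fun u) hDa, taylorSeries_mul analyticAt_const hDa,
    taylorSeries_const, taylorSeries_const, taylorSeries_id, taylorSeries_aeval] at h2
  have h3 : shiftSeries Q u = PowerSeries.X * taylorSeries D u := by
    rw [shiftSeries]; linear_combination -h2
  -- `D` may vanish away from `u`, so the product is `1` only locally; this is enough for
  -- derivatives at `u`.
  have h4 : D * lagrangeKernel Q u =ᶠ[nhds u] fun _ => 1 := by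
    have h5 : D u ≠ 0 := by rwa [hD, dslope_aeval_same]
    filter_upwards [hDa.continuousAt.eventually_ne h5] with x hx
    rw [lagrangeKernel_eq_inv, Pi.mul_apply, Pi.inv_apply, mul_inv_cancel₀ hx]
  have h6 : taylorSeries D u * taylorSeries (lagrangeKernel Q u) u = 1 := by
    rw [← taylorSeries_mul hDa (analyticAt_lagrangeKernel hu), ← map_one PowerSeries.C,
      ← taylorSeries_const 1 u]
    ext n
    simp only [taylorSeries, PowerSeries.coeff_mk, h4.iteratedDeriv_eq n]
  rw [h3, mul_assoc, h6, mul_one]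

theorem constantCoeff_aeval (f : PowerSeries ℂ) (Q : ℚ[X]) :
    PowerSeries.constantCoeff (aeval f Q) = aeval (PowerSeries.constantCoeff f) Q := by
  rw [aeval_def, hom_eval₂, aeval_def]
  congr 1

theorem constantCoeff_shiftSeries (Q : ℚ[X]) (u : ℂ) :
    PowerSeries.constantCoeff (shiftSeries Q u) = 0 := by
  rw [shiftSeries, map_sub, constantCoeff_aeval]
  simp

theorem coeff_one_shiftSeries (Q : ℚ[X]) (u : ℂ) :
    PowerSeries.coeff 1 (shiftSeries Q u) = aeval u (derivative Q) := by
  rw [shiftSeries, ← taylorSeries_aeval, map_sub, taylorSeries, PowerSeries.coeff_mk,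
    iteratedDeriv_one, Polynomial.deriv_aeval]
  simp

/-! ### `Φ_u` as a rescaled compositional inverse -/

/-- Both sides of the inverse are needed: `ψ(w) = X` feeds Lagrange inversion, `w(ψ) = X` the
functional equation. -/
theorem exists_subst_inverse_shiftSeries {Q : ℚ[X]} {u : ℂ} (hu : aeval u (derivative Q) ≠ 0) :
    ∃ ψ : PowerSeries ℂ, PowerSeries.constantCoeff ψ = 0 ∧
      ψ.subst (shiftSeries Q u) = PowerSeries.X ∧ (shiftSeries Q u).subst ψ = PowerSeries.X := by
  have h : IsUnit (PowerSeries.coeff 1 (shiftSeries Q u)) := by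
    rw [coeff_one_shiftSeries]; exact hu.isUnit
  exact ⟨PowerSeries.substInvOfIsUnit _ h, by simp,
    PowerSeries.subst_substInvOfIsUnit_left _ (constantCoeff_shiftSeries Q u) h,
    PowerSeries.subst_substInvOfIsUnit_right _ (constantCoeff_shiftSeries Q u) h⟩

theorem coeff_succ_lagrangeSeries (Q : ℚ[X]) (u : ℂ) (n : ℕ) :
    PowerSeries.coeff (n + 1) (lagrangeSeries Q u) = (-aeval u Q) ^ (n + 1) / ((n : ℂ) + 1) *
      (iteratedDeriv n (fun x => lagrangeKernel Q u x ^ (n + 1)) u / (n.factorial : ℂ)) := by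
  rw [lagrangeSeries, PowerSeries.coeff_mk, if_neg n.succ_ne_zero, Nat.add_sub_cancel,
    Nat.factorial_succ, neg_pow (aeval u Q)]
  push_cast
  have := Nat.factorial_ne_zero n
  have : (n : ℂ) + 1 ≠ 0 := by exact_mod_cast n.succ_ne_zero
  field_simp

theorem coeff_zero_lagrangeSeries (Q : ℚ[X]) (u : ℂ) :
    PowerSeries.coeff 0 (lagrangeSeries Q u) = u := by
  simp [lagrangeSeries]

theorem coeff_succ_lagrangeSeries_of_subst {Q : ℚ[X]} {u : ℂ} (hu : aeval u (derivative Q) ≠ 0)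
    {ψ : PowerSeries ℂ} (hψ : ψ.subst (shiftSeries Q u) = PowerSeries.X) (n : ℕ) :
    PowerSeries.coeff (n + 1) (lagrangeSeries Q u) =
      (-aeval u Q) ^ (n + 1) * PowerSeries.coeff (n + 1) ψ := by
  have h := PowerSeries.coeff_of_subst_eq_X (constantCoeff_shiftSeries Q u)
    (shiftSeries_mul_taylorSeries hu) hψ n
  rw [← taylorSeries_pow (analyticAt_lagrangeKernel hu), taylorSeries, PowerSeries.coeff_mk] at h
  rw [coeff_succ_lagrangeSeries, ← h]
  have : (n : ℂ) + 1 ≠ 0 := by exact_mod_cast n.succ_ne_zero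
  field_simp

theorem lagrangeSeries_eq_rescale {Q : ℚ[X]} {u : ℂ} (hu : aeval u (derivative Q) ≠ 0)
    {ψ : PowerSeries ℂ} (h0 : PowerSeries.constantCoeff ψ = 0)
    (hψ : ψ.subst (shiftSeries Q u) = PowerSeries.X) :
    lagrangeSeries Q u = PowerSeries.rescale (-aeval u Q) (ψ + PowerSeries.C u) := by
  ext n
  cases n with
  | zero =>
    rw [coeff_zero_lagrangeSeries, PowerSeries.coeff_rescale, map_add,
      PowerSeries.coeff_zero_eq_constantCoeff_apply, h0]
    simp
  | succ n =>
    rw [coeff_succ_lagrangeSeries_of_subst hu hψ, PowerSeries.coeff_rescale, map_add,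
      PowerSeries.coeff_C, if_neg n.succ_ne_zero, add_zero]

theorem aeval_ringHom_apply (φ : PowerSeries ℂ →+* PowerSeries ℂ) (f : PowerSeries ℂ) (Q : ℚ[X]) :
    φ (aeval f Q) = aeval (φ f) Q :=
  (Polynomial.aeval_algHom_apply φ.toRatAlgHom f Q).symm

/-- The series solves `Q(Φ(z)) = (1 - z) Q(u)`. -/
theorem aeval_lagrangeSeries {Q : ℚ[X]} {u : ℂ} (hu : aeval u (derivative Q) ≠ 0) :
    aeval (lagrangeSeries Q u) Q = (1 - PowerSeries.X) * PowerSeries.C (aeval u Q) := by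
  obtain ⟨ψ, h0, hψ, hψ'⟩ := exists_subst_inverse_shiftSeries hu
  have hs : PowerSeries.HasSubst ψ := PowerSeries.HasSubst.of_constantCoeff_zero' h0
  have h1 : aeval (ψ + PowerSeries.C u) Q = PowerSeries.X + PowerSeries.C (aeval u Q) := by
    rw [shiftSeries, ← PowerSeries.coe_substAlgHom hs] at hψ'
    have h2 := aeval_ringHom_apply (PowerSeries.substAlgHom (R := ℂ) hs : PowerSeries ℂ →+* _)
      (PowerSeries.X + PowerSeries.C u) Q
    simp only [RingHom.coe_coe, map_add, PowerSeries.substAlgHom_X] at h2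
    have hC : ∀ c : ℂ, PowerSeries.substAlgHom (R := ℂ) hs (PowerSeries.C c) = PowerSeries.C c :=
      fun c => (PowerSeries.substAlgHom (R := ℂ) hs).commutes c
    rw [map_sub, hC, h2, hC] at hψ'
    linear_combination hψ'
  rw [lagrangeSeries_eq_rescale hu h0 hψ, ← aeval_ringHom_apply, h1, map_add,
    PowerSeries.rescale_X]
  have hC : PowerSeries.rescale (-aeval u Q) (PowerSeries.C (aeval u Q))
      = PowerSeries.C (aeval u Q) := by
    ext n
    cases n <;> simp [PowerSeries.coeff_rescale, PowerSeries.coeff_C]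
  rw [hC, map_neg]
  ring

/-! ### Arithmetic of `ℚ(i)` -/

theorem exists_rat_of_mem_gaussField {a : ℂ} (ha : a ∈ GaussField) :
    ∃ p q : ℚ, a = p + q * Complex.I := by
  induction ha using IntermediateField.adjoin_induction with
  | mem x hx =>
    rw [Set.mem_singleton_iff] at hx
    exact ⟨0, 1, by simp [hx]⟩
  | algebraMap x => exact ⟨x, 0, by simp⟩
  | add x y _ _ hx hy =>
    obtain ⟨p, q, rfl⟩ := hx
    obtain ⟨r, s, rfl⟩ := hy
    exact ⟨p + r, q + s, by push_cast; ring⟩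
  | inv x _ hx =>
    obtain ⟨p, q, rfl⟩ := hx
    refine ⟨p / (p ^ 2 + q ^ 2), -q / (p ^ 2 + q ^ 2), ?_⟩
    -- When the norm vanishes, `p = q = 0` and both sides are zero by the convention `0⁻¹ = 0`.
    by_cases h : (p : ℂ) ^ 2 + (q : ℂ) ^ 2 = 0
    · have h' : p ^ 2 + q ^ 2 = 0 := by exact_mod_cast h
      have hp : p = 0 := by nlinarith [sq_nonneg p, sq_nonneg q]
      have hq : q = 0 := by nlinarith [sq_nonneg p, sq_nonneg q]
      simp [hp, hq]
    · have h1 : ((p : ℂ) + q * Complex.I) * (p - q * Complex.I) = (p : ℂ) ^ 2 + (q : ℂ) ^ 2 := by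
        linear_combination -(q : ℂ) ^ 2 * Complex.I_sq
      apply inv_eq_of_mul_eq_one_right
      push_cast
      field_simp
      linear_combination h1
  | mul x y _ _ hx hy =>
    obtain ⟨p, q, rfl⟩ := hx
    obtain ⟨r, s, rfl⟩ := hy
    refine ⟨p * r - q * s, p * s + q * r, ?_⟩
    push_cast
    linear_combination (q : ℂ) * s * Complex.I_sq

theorem rat_add_rat_mul_I_mem_gaussField (p q : ℚ) : (p : ℂ) + q * Complex.I ∈ GaussField :=
  add_mem (GaussField.algebraMap_mem p)
    (mul_mem (GaussField.algebraMap_mem q) (IntermediateField.mem_adjoin_simple_self ℚ _))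

theorem aeval_gaussField_quadratic (p q : ℚ) (b : ℂ) :
    aeval b (X ^ 2 - C (2 * p) * X + C (p ^ 2 + q ^ 2) : ℚ[X]) =
      (b - (p + q * Complex.I)) * (b - (p - q * Complex.I)) := by
  simp only [map_add, map_sub, map_mul, map_pow, aeval_X, aeval_C, eq_ratCast]
  push_cast
  linear_combination (q : ℂ) ^ 2 * Complex.I_sq

theorem isIntegral_of_mem_gaussField {a : ℂ} (ha : a ∈ GaussField) : IsIntegral ℚ a := by
  obtain ⟨p, q, rfl⟩ := exists_rat_of_mem_gaussField ha
  refine ⟨X ^ 2 - C (2 * p) * X + C (p ^ 2 + q ^ 2), by monicity!, ?_⟩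
  rw [← aeval_def, aeval_gaussField_quadratic, sub_self, zero_mul]

/-- The minimal polynomial divides the quadratic with roots `p ± q i`, which have equal modulus.
Bounding the conjugates of a coefficient thus reduces to bounding the coefficient. -/
theorem norm_eq_of_isConjRoot_of_mem_gaussField {a b : ℂ} (ha : a ∈ GaussField)
    (h : IsConjRoot ℚ a b) : ‖b‖ = ‖a‖ := by
  obtain ⟨p, q, rfl⟩ := exists_rat_of_mem_gaussField ha
  have h1 : minpoly ℚ ((p : ℂ) + q * Complex.I) ∣ X ^ 2 - C (2 * p) * X + C (p ^ 2 + q ^ 2) :=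
    minpoly.dvd _ _ (by rw [aeval_gaussField_quadratic, sub_self, zero_mul])
  rw [show minpoly ℚ ((p : ℂ) + q * Complex.I) = minpoly ℚ b from h] at h1
  have h2 := (aeval_gaussField_quadratic p q b).symm.trans
    (aeval_eq_zero_of_dvd_aeval_eq_zero h1 (minpoly.aeval ℚ b))
  rcases mul_eq_zero.1 h2 with h3 | h3
  · rw [sub_eq_zero.1 h3]
  · rw [sub_eq_zero.1 h3, ← Complex.norm_conj]
    simp

theorem exists_gaussField_near (z : ℂ) {ε : ℝ} (hε : 0 < ε) :
    ∃ u ∈ GaussField, ‖u - z‖ < ε := by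
  obtain ⟨p, hp1, hp2⟩ := exists_rat_btwn (show z.re < z.re + ε / 2 by linarith)
  obtain ⟨q, hq1, hq2⟩ := exists_rat_btwn (show z.im < z.im + ε / 2 by linarith)
  refine ⟨p + q * Complex.I, rat_add_rat_mul_I_mem_gaussField p q, ?_⟩
  refine (Complex.norm_le_abs_re_add_abs_im _).trans_lt ?_
  have h1 : ((p : ℂ) + q * Complex.I - z).re = p - z.re := by simp
  have h2 : ((p : ℂ) + q * Complex.I - z).im = q - z.im := by simp
  rw [h1, h2, abs_of_pos (by linarith), abs_of_pos (by linarith)]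
  linarith

/-- The ring of those elements of `ℚ(i)` that are integral over `ℤ`. -/
noncomputable def gaussIntegers : Subring ℂ :=
  (integralClosure ℤ ℂ).toSubring ⊓ GaussField.toSubfield.toSubring

theorem mem_gaussIntegers {a : ℂ} : a ∈ gaussIntegers ↔ IsIntegral ℤ a ∧ a ∈ GaussField :=
  Iff.rfl

theorem exists_natCast_mul_mem_gaussIntegers {a : ℂ} (ha : a ∈ GaussField) :
    ∃ N : ℕ, N ≠ 0 ∧ (N : ℂ) * a ∈ gaussIntegers := by
  have h1 : IsAlgebraic ℤ a :=
    (IsFractionRing.isAlgebraic_iff ℤ ℚ ℂ).2 (isIntegral_of_mem_gaussField ha).isAlgebraic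
  obtain ⟨y, hy, hi⟩ := h1.exists_integral_multiple
  refine ⟨y.natAbs, by simpa using hy, mem_gaussIntegers.2 ⟨?_, mul_mem (natCast_mem _ _) ha⟩⟩
  rw [zsmul_eq_mul] at hi
  rcases Int.natAbs_eq y with h | h
  · rw [h] at hi; simpa using hi
  · rw [h] at hi; simpa using hi.neg

theorem exists_natCast_mul_mem_gaussIntegers_finset (s : Finset ℂ) (hs : ∀ a ∈ s, a ∈ GaussField) :
    ∃ N : ℕ, N ≠ 0 ∧ ∀ a ∈ s, (N : ℂ) * a ∈ gaussIntegers := by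
  classical
  induction s using Finset.induction_on with
  | empty => exact ⟨1, one_ne_zero, by simp⟩
  | insert a s _ ih =>
    obtain ⟨N, hN, h1⟩ := ih fun b hb => hs b (Finset.mem_insert_of_mem hb)
    obtain ⟨M, hM, h2⟩ :=
      exists_natCast_mul_mem_gaussIntegers (hs a (Finset.mem_insert_self a s))
    refine ⟨N * M, mul_ne_zero hN hM, fun b hb => ?_⟩
    push_cast
    rcases Finset.mem_insert.1 hb with rfl | hb
    · rw [mul_assoc]; exact mul_mem (natCast_mem _ _) h2
    · rw [mul_comm (N : ℂ), mul_assoc]; exact mul_mem (natCast_mem _ _) (h1 b hb)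

/-! ### Denominators of the coefficients -/

/-- The compositional inverse of `t + O(t²)` over a subring has coefficients in that subring. -/
theorem PowerSeries.exists_subst_inverse_coeff_mem (S : Subring ℂ) {w : PowerSeries ℂ}
    (hS : ∀ n, PowerSeries.coeff n w ∈ S) (h0 : PowerSeries.constantCoeff w = 0)
    (h1 : PowerSeries.coeff 1 w = 1) :
    ∃ φ : PowerSeries ℂ, PowerSeries.constantCoeff φ = 0 ∧ (∀ n, PowerSeries.coeff n φ ∈ S) ∧
      w.subst φ = PowerSeries.X := by
  -- Lifting to `S` makes the inverse available over `S` itself, since the linear coefficient `1` is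
  -- a unit there.
  set v : PowerSeries S := PowerSeries.mk fun n => ⟨PowerSeries.coeff n w, hS n⟩ with hv
  have hvw : PowerSeries.map S.subtype v = w := by ext n; simp [hv]
  have hv0 : PowerSeries.constantCoeff v = 0 := by
    rw [← PowerSeries.coeff_zero_eq_constantCoeff_apply, hv, PowerSeries.coeff_mk]
    exact Subtype.ext (by simpa using h0)
  have hv1 : IsUnit (PowerSeries.coeff 1 v) := by
    have : PowerSeries.coeff 1 v = 1 := by
      rw [hv, PowerSeries.coeff_mk]; exact Subtype.ext (by simpa using h1)
    rw [this]; exact isUnit_one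
  refine ⟨PowerSeries.map S.subtype (v.substInvOfIsUnit hv1), ?_, fun n => ?_, ?_⟩
  · rw [← PowerSeries.coeff_zero_eq_constantCoeff_apply, PowerSeries.coeff_map,
      PowerSeries.coeff_zero_eq_constantCoeff_apply]
    simp
  · rw [PowerSeries.coeff_map]; exact Subtype.prop _
  · have h := PowerSeries.subst_substInvOfIsUnit_right v hv0 hv1
    have h2 := congrArg (PowerSeries.map S.subtype) h
    rw [PowerSeries.map_X] at h2
    rw [← h2, ← hvw]
    exact (PowerSeries.map_subst (PowerSeries.HasSubst.substInvOfIsUnit v hv1) v).symm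

theorem exists_polynomial_eq_aeval_X_add_C (Q : ℚ[X]) {u : ℂ} (hu : u ∈ GaussField) :
    ∃ P : GaussField[X], ∀ n,
      PowerSeries.coeff n (aeval (PowerSeries.X + PowerSeries.C u) Q) = (P.coeff n : ℂ) := by
  refine ⟨aeval (X + C ⟨u, hu⟩) Q, fun n => ?_⟩
  have h := (aeval_algHom_apply (algebraMap GaussField[X] (PowerSeries ℂ)).toRatAlgHom
    (X + C ⟨u, hu⟩) Q)
  have h2 : (algebraMap GaussField[X] (PowerSeries ℂ)).toRatAlgHom (X + C ⟨u, hu⟩)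
      = PowerSeries.X + PowerSeries.C u := by
    change algebraMap GaussField[X] (PowerSeries ℂ) (X + C ⟨u, hu⟩) = _
    rw [PowerSeries.algebraMap_apply']
    simp
  rw [← h2, h]
  change PowerSeries.coeff n (algebraMap GaussField[X] (PowerSeries ℂ) _) = _
  rw [PowerSeries.algebraMap_apply', PowerSeries.coeff_map, Polynomial.coeff_coe]
  rfl

theorem aeval_mem_gaussField (Q : ℚ[X]) {u : ℂ} (hu : u ∈ GaussField) : aeval u Q ∈ GaussField :=
  aeval_algebraMap_apply ℂ (⟨u, hu⟩ : GaussField) Q ▸ (aeval (⟨u, hu⟩ : GaussField) Q).2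

/-- The coefficients of the inverse of `Q(u + t) - Q(u)`, rescaled, are integral. -/
theorem exists_coeff_subst_inverse_mem_gaussIntegers {Q : ℚ[X]} {u : ℂ} (hK : u ∈ GaussField)
    (hu : aeval u (derivative Q) ≠ 0) {ψ : PowerSeries ℂ}
    (hψ : ψ.subst (shiftSeries Q u) = PowerSeries.X) :
    ∃ c ∈ GaussField, c ≠ 0 ∧ ∀ n, c ^ n * PowerSeries.coeff n ψ ∈ gaussIntegers := by
  obtain ⟨P, hP⟩ := exists_polynomial_eq_aeval_X_add_C Q hK
  set w := shiftSeries Q u with hw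
  set h := aeval u (derivative Q) with hh
  have hhK : h ∈ GaussField := aeval_mem_gaussField _ hK
  have hw0 : PowerSeries.constantCoeff w = 0 := constantCoeff_shiftSeries Q u
  have hw1 : PowerSeries.coeff 1 w = h := coeff_one_shiftSeries Q u
  have hwP : ∀ n, PowerSeries.coeff (n + 1) w = (P.coeff (n + 1) : ℂ) := fun n => by
    rw [hw, shiftSeries, map_sub, hP, PowerSeries.coeff_C, if_neg n.succ_ne_zero, sub_zero]
  -- `P` is a polynomial, so finitely many quotients need a common denominator.
  obtain ⟨N, hN, hNS⟩ := exists_natCast_mul_mem_gaussIntegers_finset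
    ((Finset.range (P.natDegree + 1)).image fun n => (P.coeff n : ℂ) / h) (by
      intro a ha
      obtain ⟨n, -, rfl⟩ := Finset.mem_image.1 ha
      exact div_mem (P.coeff n).2 hhK)
  have hNS' : ∀ n, (N : ℂ) * ((P.coeff n : ℂ) / h) ∈ gaussIntegers := fun n => by
    by_cases hn : n ∈ Finset.range (P.natDegree + 1)
    · exact hNS _ (Finset.mem_image_of_mem _ hn)
    · rw [coeff_eq_zero_of_natDegree_lt (by simpa using hn)]
      simp [zero_mem]
  have hN' : (N : ℂ) ≠ 0 := by exact_mod_cast hN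
  have hv : ∀ n, PowerSeries.coeff n (PowerSeries.C (h * N)⁻¹ * PowerSeries.rescale (N : ℂ) w)
      = (h * N)⁻¹ * ((N : ℂ) ^ n * PowerSeries.coeff n w) := fun n => by
    rw [PowerSeries.coeff_C_mul, PowerSeries.coeff_rescale]
  -- With `p_n` the coefficients of `P`, the series `(hN)⁻¹ w(N t)` is `t + ∑ N^(n-1) (p_n / h) t^n`
  -- over `n ≥ 2`; each term has a factor `N` to clear `p_n / h`.
  obtain ⟨φ, hφ0, hφS, hφ⟩ := PowerSeries.exists_subst_inverse_coeff_mem gaussIntegers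
    (w := PowerSeries.C (h * N)⁻¹ * PowerSeries.rescale (N : ℂ) w) (fun n => by
      rw [hv]
      match n with
      | 0 => simp [hw0, zero_mem]
      | 1 =>
        rw [hw1, pow_one, mul_comm h, inv_mul_cancel₀ (mul_ne_zero hN' hu)]
        exact one_mem _
      | n + 2 =>
        rw [hwP]
        have : (h * (N : ℂ))⁻¹ * ((N : ℂ) ^ (n + 2) * (P.coeff (n + 2) : ℂ))
            = (N : ℂ) ^ n * (N * ((P.coeff (n + 2) : ℂ) / h)) := by
          field_simp
          ring
        rw [this]
        exact mul_mem (pow_mem (natCast_mem _ _) _) (hNS' _)) (by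
      rw [← PowerSeries.coeff_zero_eq_constantCoeff_apply, hv]
      simp [hw0]) (by
      rw [hv, hw1, pow_one, mul_comm h, inv_mul_cancel₀ (mul_ne_zero hN' hu)])
  have hsφ : PowerSeries.HasSubst φ := PowerSeries.HasSubst.of_constantCoeff_zero' hφ0
  have hsw : PowerSeries.HasSubst w := PowerSeries.HasSubst.of_constantCoeff_zero' hw0
  have hsX : ∀ c : ℂ, PowerSeries.HasSubst (c • (PowerSeries.X : PowerSeries ℂ)) :=
    fun c => PowerSeries.HasSubst.smul_X' c
  have hsN : PowerSeries.HasSubst ((N : ℂ) • φ) := PowerSeries.HasSubst.smul' _ hsφ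
  have h1 : w.subst ((N : ℂ) • φ) = (h * N) • (PowerSeries.X : PowerSeries ℂ) := by
    rw [← PowerSeries.smul_eq_C_mul, PowerSeries.subst_smul hsφ,
      PowerSeries.rescale_eq_subst, PowerSeries.subst_comp_subst_apply (hsX _) hsφ,
      PowerSeries.subst_smul hsφ, PowerSeries.subst_X hsφ] at hφ
    rw [← hφ, smul_smul, mul_inv_cancel₀ (mul_ne_zero hu hN'), one_smul]
  -- Apply `ψ` to `w(N φ) = h N X`; hence the choice `c = h N`.
  have h2 : PowerSeries.rescale (h * N) ψ = (N : ℂ) • φ := by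
    rw [PowerSeries.rescale_eq_subst, ← h1, ← PowerSeries.subst_comp_subst_apply hsw hsN, hψ,
      PowerSeries.subst_X hsN]
  refine ⟨h * N, mul_mem hhK (natCast_mem _ _), mul_ne_zero hu hN', fun n => ?_⟩
  rw [← PowerSeries.coeff_rescale, h2, PowerSeries.coeff_smul, smul_eq_mul]
  exact mul_mem (natCast_mem _ _) (hφS n)

/-- `M` clears `u` and `-Q(u) / c`. The exponent `n + 1` leaves one factor `M` for the constant term
`u`. -/
theorem exists_natCast_pow_mul_coeff_lagrangeSeries_mem {Q : ℚ[X]} {u : ℂ} (hK : u ∈ GaussField)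
    (hu : aeval u (derivative Q) ≠ 0) :
    ∃ M : ℕ, M ≠ 0 ∧
      ∀ n, (M : ℂ) ^ (n + 1) * PowerSeries.coeff n (lagrangeSeries Q u) ∈ gaussIntegers := by
  obtain ⟨ψ, -, hψ, -⟩ := exists_subst_inverse_shiftSeries hu
  obtain ⟨c, hcK, hc0, hc⟩ := exists_coeff_subst_inverse_mem_gaussIntegers hK hu hψ
  obtain ⟨M, hM, hMS⟩ := exists_natCast_mul_mem_gaussIntegers_finset {u, -aeval u Q / c} (by
    simp only [Finset.mem_insert, Finset.mem_singleton, forall_eq_or_imp, forall_eq]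
    exact ⟨hK, div_mem (neg_mem (aeval_mem_gaussField Q hK)) hcK⟩)
  refine ⟨M, hM, fun n => ?_⟩
  cases n with
  | zero =>
    rw [coeff_zero_lagrangeSeries, zero_add, pow_one]
    exact hMS _ (by simp)
  | succ n =>
    rw [coeff_succ_lagrangeSeries_of_subst hu hψ]
    have : (M : ℂ) ^ (n + 1 + 1) * ((-aeval u Q) ^ (n + 1) * PowerSeries.coeff (n + 1) ψ)
        = M * ((M * (-aeval u Q / c)) ^ (n + 1) * (c ^ (n + 1) * PowerSeries.coeff (n + 1) ψ)) := by
      generalize -aeval u Q = q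
      rw [mul_pow, div_pow]
      field_simp
      ring
    rw [this]
    exact mul_mem (natCast_mem _ _) (mul_mem (pow_mem (hMS _ (by simp)) _) (hc _))

theorem hasCoeffsIn_lagrangeSeries {Q : ℚ[X]} {u : ℂ} (hK : u ∈ GaussField)
    (hu : aeval u (derivative Q) ≠ 0) : HasCoeffsIn GaussField (lagrangeSeries Q u) := by
  obtain ⟨M, hM, h⟩ := exists_natCast_pow_mul_coeff_lagrangeSeries_mem hK hu
  intro n
  have hM' : (M : ℂ) ^ (n + 1) ≠ 0 := pow_ne_zero _ (by exact_mod_cast hM)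
  rw [← mul_div_cancel_left₀ (PowerSeries.coeff n (lagrangeSeries Q u)) hM']
  exact div_mem (h n).2 (pow_mem (natCast_mem _ _) _)

/-! ### Differential equations for integral power series -/

section

variable {K : IntermediateField ℚ ℂ}

theorem algebraMap_polynomial_powerSeries (p : K[X]) :
    algebraMap K[X] (PowerSeries ℂ) p = (p.map (algebraMap K ℂ) : PowerSeries ℂ) := by
  rw [PowerSeries.algebraMap_apply', Polynomial.polynomial_map_coe]

theorem derivative_algebraMap_polynomial (p : K[X]) :
    PowerSeries.derivative ℂ (algebraMap K[X] (PowerSeries ℂ) p)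
      = algebraMap K[X] (PowerSeries ℂ) (derivative p) := by
  rw [algebraMap_polynomial_powerSeries, algebraMap_polynomial_powerSeries,
    PowerSeries.derivative_coe, Polynomial.derivative_map]

/-- If `D f'` lies in a `K[z]`-algebra generated by `f`, then `D` maps the derivatives of elements
of the algebra into it. -/
theorem mul_derivative_mem_adjoin {f : PowerSeries ℂ} {D : K[X]}
    (hD : algebraMap K[X] (PowerSeries ℂ) D * PowerSeries.derivative ℂ f
      ∈ Algebra.adjoin K[X] {f}) {g : PowerSeries ℂ} (hg : g ∈ Algebra.adjoin K[X] {f}) :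
    algebraMap K[X] (PowerSeries ℂ) D * PowerSeries.derivative ℂ g ∈ Algebra.adjoin K[X] {f} := by
  induction hg using Algebra.adjoin_induction with
  | mem x hx => rw [Set.mem_singleton_iff.1 hx]; exact hD
  | algebraMap p =>
    rw [derivative_algebraMap_polynomial]
    exact mul_mem (Subalgebra.algebraMap_mem _ _) (Subalgebra.algebraMap_mem _ _)
  | add x y _ _ hx hy => rw [map_add, mul_add]; exact add_mem hx hy
  | mul x y hx' hy' hx hy =>
    rw [Derivation.leibniz, smul_eq_mul, smul_eq_mul, mul_add, mul_left_comm, mul_left_comm _ y]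
    exact add_mem (mul_mem hx' hy) (mul_mem hy' hx)

/-- Induction through `D (D^j f⁽ʲ⁾)' = D^(j+1) f⁽ʲ⁺¹⁾ + j D' · D^j f⁽ʲ⁾`, whose last term already
lies in the algebra. -/
theorem pow_mul_iterate_derivative_mem_adjoin {f : PowerSeries ℂ} {D : K[X]}
    (hD : algebraMap K[X] (PowerSeries ℂ) D * PowerSeries.derivative ℂ f
      ∈ Algebra.adjoin K[X] {f}) (j : ℕ) :
    algebraMap K[X] (PowerSeries ℂ) (D ^ j) * (PowerSeries.derivative ℂ)^[j] f
      ∈ Algebra.adjoin K[X] {f} := by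
  induction j with
  | zero => simp
  | succ j ih =>
    have h := mul_derivative_mem_adjoin hD ih
    rw [Derivation.leibniz, derivative_algebraMap_polynomial, smul_eq_mul, smul_eq_mul,
      derivative_pow] at h
    rw [Function.iterate_succ_apply']
    have h2 : algebraMap K[X] (PowerSeries ℂ) (C (j : K) * derivative D) *
        (algebraMap K[X] (PowerSeries ℂ) (D ^ j) * (PowerSeries.derivative ℂ)^[j] f)
        ∈ Algebra.adjoin K[X] {f} := mul_mem (Subalgebra.algebraMap_mem _ _) ih
    convert! sub_mem h h2 using 1
    cases j with
    | zero => simp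
    | succ j =>
      simp only [map_mul, map_pow, Nat.add_sub_cancel]
      ring

/-- A power series integral over `K[z]`, with a multiple of its derivative in the algebra that
it generates, satisfies a linear differential equation. -/
theorem satisfiesLinearODE_of_isIntegral (hK : ∀ a ∈ K, IsAlgebraic ℚ a) {f : PowerSeries ℂ}
    (hf : IsIntegral K[X] f) {D : K[X]} (hD0 : D ≠ 0)
    (hD : algebraMap K[X] (PowerSeries ℂ) D * PowerSeries.derivative ℂ f
      ∈ Algebra.adjoin K[X] {f}) : SatisfiesLinearODE f := by
  have hfin : Module.Finite K[X] (Algebra.adjoin K[X] {f}) :=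
    Module.Finite.iff_fg.2 hf.fg_adjoin_singleton
  set v : ℕ → Algebra.adjoin K[X] {f} := fun j =>
    ⟨_, pow_mul_iterate_derivative_mem_adjoin hD j⟩ with hv
  -- A finite module over the Noetherian ring `K[X]` contains no infinite independent family.
  have hdep : ¬ LinearIndependent K[X] v := fun h => by
    have : IsNoetherian K[X] (Algebra.adjoin K[X] {f}) := inferInstance
    exact Infinite.not_finite h.finite_of_isNoetherian
  obtain ⟨s, c, hs, i, his, hi⟩ := not_linearIndependent_iff.1 hdep
  classical
  -- The largest index with nonzero coefficient is the order of the equation, so the leading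
  -- coefficient `c_r D^r` is nonzero.
  set t := s.filter fun j => c j ≠ 0 with ht
  have htne : t.Nonempty := ⟨i, by simp [ht, his, hi]⟩
  set r := t.max' htne with hr
  have hrt : r ∈ t := t.max'_mem htne
  set p : ℕ → K[X] := fun j => if j ∈ t then c j * D ^ j else 0 with hp
  refine ⟨r, fun j => (p j).map (algebraMap K ℂ), fun j k => ?_, ?_, ?_⟩
  · rw [Polynomial.coeff_map]
    exact hK _ (((p j).coeff k).2)
  · rw [Ne, Polynomial.map_eq_zero]
    simp only [hp, if_pos hrt]
    exact mul_ne_zero (Finset.mem_filter.1 hrt).2 (pow_ne_zero _ hD0)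
  · have h1 := congrArg (Subtype.val) hs
    rw [AddSubmonoidClass.coe_finsetSum] at h1
    have h2 : t ⊆ Finset.range (r + 1) := fun j hj =>
      Finset.mem_range.2 (Nat.lt_succ_of_le (t.le_max' j hj))
    have h3 : ∑ j ∈ t, ((c j • v j : Algebra.adjoin K[X] {f}) : PowerSeries ℂ) = 0 := by
      rw [Finset.sum_subset (Finset.filter_subset _ s : t ⊆ s), h1]
      · rfl
      · intro j hj hjt
        have : c j = 0 := by
          by_contra hc
          exact hjt (Finset.mem_filter.2 ⟨hj, hc⟩)
        rw [this, zero_smul]; rfl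
    rw [← Finset.sum_subset h2, ← h3]
    · refine Finset.sum_congr rfl fun j hj => ?_
      simp only [hp, if_pos hj, hv]
      rw [← algebraMap_polynomial_powerSeries, map_mul, mul_assoc, ← Algebra.smul_def]
      rfl
    · intro j _ hj
      simp [hp, hj]

theorem aeval_map_rat (f : PowerSeries ℂ) (P : ℚ[X]) :
    aeval f (P.map (algebraMap ℚ K[X])) = aeval f P := by
  rw [aeval_def, eval₂_map, aeval_def]
  congr 1
  exact RingHom.ext_rat _ _

theorem isIntegral_of_aeval_eq_algebraMap {Q : ℚ[X]} (hQ : derivative Q ≠ 0) {f : PowerSeries ℂ}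
    {p : K[X]} (h : aeval f Q = algebraMap K[X] (PowerSeries ℂ) p) : IsIntegral K[X] f := by
  have hQ0 : Q ≠ 0 := by rintro rfl; simp at hQ
  have hm : ((Q * C Q.leadingCoeff⁻¹).map (algebraMap ℚ K[X])).Monic :=
    (monic_mul_leadingCoeff_inv hQ0).map _
  refine IsIntegral.of_aeval_monic hm ?_ ?_
  · rw [(monic_mul_leadingCoeff_inv hQ0).natDegree_map, natDegree_mul_leadingCoeff_inv Q hQ0]
    exact fun h0 => hQ (derivative_of_natDegree_zero h0)
  · have h2 : aeval f ((Q * C Q.leadingCoeff⁻¹).map (algebraMap ℚ K[X]))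
        = algebraMap K[X] (PowerSeries ℂ) (p * C (algebraMap ℚ K Q.leadingCoeff⁻¹)) := by
      rw [aeval_map_rat, map_mul, h, map_mul, aeval_C]
      congr 1
      exact RingHom.congr_fun (RingHom.ext_rat (algebraMap ℚ (PowerSeries ℂ))
        ((algebraMap K[X] (PowerSeries ℂ)).comp (C.comp (algebraMap ℚ K)))) _
    rw [h2]
    exact isIntegral_algebraMap

end

/-- Differentiating the functional equation gives `Q'(f) f' = -Q(u)`. Here `Q'(f)` has constant term
`Q'(u) ≠ 0` and is integral over `K[z]`, so it divides a nonzero polynomial `D = Q'(f) B`; then `D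
f' = -Q(u) B` lies in `K[z][f]`. -/
theorem satisfiesLinearODE_lagrangeSeries {Q : ℚ[X]} {u : ℂ} (hK : u ∈ GaussField)
    (hu : aeval u (derivative Q) ≠ 0) : SatisfiesLinearODE (lagrangeSeries Q u) := by
  set f := lagrangeSeries Q u with hf
  set c : GaussField := ⟨aeval u Q, aeval_mem_gaussField Q hK⟩ with hc
  have h1 : aeval f Q = algebraMap GaussField[X] (PowerSeries ℂ) ((1 - X) * C c) := by
    rw [hf, aeval_lagrangeSeries hu, algebraMap_polynomial_powerSeries]
    simp [hc]
  have hint : IsIntegral GaussField[X] f :=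
    isIntegral_of_aeval_eq_algebraMap (by rintro h; simp [h] at hu) h1
  have hmem : ∀ P : ℚ[X], aeval f P ∈ Algebra.adjoin GaussField[X] {f} := fun P => by
    rw [← aeval_map_rat (K := GaussField)]
    exact aeval_mem_adjoin_singleton _ _
  set q : Algebra.adjoin GaussField[X] {f} := ⟨aeval f (derivative Q), hmem _⟩ with hq
  have hq0 : q ≠ 0 := by
    intro h
    have h2 : aeval f (derivative Q) = 0 := congrArg Subtype.val h
    have h3 := constantCoeff_aeval f (derivative Q)
    rw [h2, map_zero, ← PowerSeries.coeff_zero_eq_constantCoeff_apply, hf,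
      coeff_zero_lagrangeSeries] at h3
    exact hu h3.symm
  have hqint : IsIntegral GaussField[X] q := by
    have : Module.Finite GaussField[X] (Algebra.adjoin GaussField[X] {f}) :=
      Module.Finite.iff_fg.2 hint.fg_adjoin_singleton
    exact IsIntegral.of_finite _ _
  obtain ⟨D, hD0, B, hB⟩ := hqint.isAlgebraic.exists_nonzero_dvd (mem_nonZeroDivisors_of_ne_zero hq0)
  have hder : aeval f (derivative Q) * PowerSeries.derivative ℂ f
      = algebraMap GaussField[X] (PowerSeries ℂ) (C (-c)) := by
    have h2 := congrArg (PowerSeries.derivative ℂ) h1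
    rw [derivative_algebraMap_polynomial] at h2
    have h3 := Derivation.comp_aeval_eq (a := f) ((PowerSeries.derivative ℂ).restrictScalars ℚ) Q
    have h4 : derivative ((1 - X) * C c) = C (-c) := by simp
    rw [← h4, ← h2]
    exact h3.symm
  refine satisfiesLinearODE_of_isIntegral
    (fun a ha => (isIntegral_of_mem_gaussField ha).isAlgebraic) hint hD0 ?_
  have hB' : algebraMap GaussField[X] (PowerSeries ℂ) D = aeval f (derivative Q) * B :=
    congrArg Subtype.val hB
  rw [hB', mul_right_comm, hder]
  exact mul_mem (Subalgebra.algebraMap_mem _ _) B.2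

/-! ### Uniform analytic estimates near a simple root -/

/-- Strict differentiability at `β` gives `|Q(x) - Q(y)| ≥ c |x - y|` near `β` with `c = |Q'(β)| /
2`. This one inequality yields injectivity and, with `|Q'(u)| ≥ c`, the kernel bound `1 / c`, both
uniform in `u`. -/
theorem exists_lagrangeKernel_bound {Q : ℚ[X]} {β : ℂ} (hβ : aeval β (derivative Q) ≠ 0) :
    ∃ ρ > 0, ∃ B > 0, ∀ u : ℂ, ‖u - β‖ < ρ → aeval u (derivative Q) ≠ 0 ∧
      DiffContOnCl ℂ (lagrangeKernel Q u) (Metric.ball u ρ) ∧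
      (∀ x ∈ Metric.closedBall u ρ, ‖lagrangeKernel Q u x‖ ≤ B) ∧
      ∀ x ∈ Metric.closedBall u ρ, ∀ y ∈ Metric.closedBall u ρ, aeval x Q = aeval y Q → x = y := by
  set c := ‖aeval β (derivative Q)‖ / 2 with hc
  have hc0 : 0 < c := half_pos (norm_pos_iff.2 hβ)
  have hstrict : HasStrictDerivAt (fun x : ℂ => aeval x Q) (aeval β (derivative Q)) β :=
    Q.hasStrictDerivAt_aeval β
  have h1 : ∀ᶠ p : ℂ × ℂ in nhds (β, β), c * ‖p.1 - p.2‖ ≤ ‖aeval p.1 Q - aeval p.2 Q‖ := by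
    have h := (hasStrictDerivAt_iff_hasStrictFDerivAt.1 hstrict).isLittleO.def hc0
    filter_upwards [h] with p hp
    have h2 : ‖(p.1 - p.2) * aeval β (derivative Q)‖ = 2 * c * ‖p.1 - p.2‖ := by
      rw [norm_mul, hc]; ring
    have h3 := norm_sub_norm_le ((p.1 - p.2) * aeval β (derivative Q)) (aeval p.1 Q - aeval p.2 Q)
    rw [norm_sub_rev ((p.1 - p.2) * _), h2] at h3
    simp only [ContinuousLinearMap.toSpanSingleton_apply, smul_eq_mul] at hp
    linarith
  have h2 : ∀ᶠ x : ℂ in nhds β, c ≤ ‖aeval x (derivative Q)‖ :=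
    ((Polynomial.continuous_aeval (derivative Q)).norm.continuousAt.eventually
      (lt_mem_nhds (show c < ‖aeval β (derivative Q)‖ by rw [hc] at hc0 ⊢; linarith))).mono
        fun x hx => hx.le
  obtain ⟨r₁, hr₁, h1⟩ := Metric.eventually_nhds_iff_ball.1 h1
  obtain ⟨r₂, hr₂, h2⟩ := Metric.eventually_nhds_iff_ball.1 h2
  set r := min r₁ r₂ with hr
  have hr0 : 0 < r := lt_min hr₁ hr₂
  -- Radius `r / 2` keeps the closed disc about `u` inside the `r`-ball about `β`.
  refine ⟨r / 2, half_pos hr0, c⁻¹, inv_pos.2 hc0, fun u hu => ?_⟩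
  have hball : ∀ x ∈ Metric.closedBall u (r / 2), dist x β < r := fun x hx => by
    have h3 := dist_triangle x u β
    rw [← dist_eq_norm] at hu
    have := Metric.mem_closedBall.1 hx
    linarith
  have hexp : ∀ x ∈ Metric.closedBall u (r / 2), ∀ y ∈ Metric.closedBall u (r / 2),
      c * ‖x - y‖ ≤ ‖aeval x Q - aeval y Q‖ := fun x hx y hy => by
    refine h1 (x, y) ?_
    rw [Metric.mem_ball, Prod.dist_eq]
    exact (max_lt (hball x hx) (hball y hy)).trans_le (min_le_left _ _)
  have huu : u ∈ Metric.closedBall u (r / 2) := Metric.mem_closedBall_self (half_pos hr0).le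
  have hder : c ≤ ‖aeval u (derivative Q)‖ :=
    h2 u (Metric.mem_ball.2 ((hball u huu).trans_le (min_le_right _ _)))
  have hds : ∀ x ∈ Metric.closedBall u (r / 2),
      c ≤ ‖dslope (fun y : ℂ => aeval y Q) u x‖ := fun x hx => by
    by_cases hxu : x = u
    · rwa [hxu, dslope_aeval_same]
    · rw [dslope_of_ne _ hxu, slope_def_field, norm_div, le_div_iff₀ (norm_pos_iff.2
        (sub_ne_zero.2 hxu))]
      exact hexp x hx u huu
  refine ⟨norm_pos_iff.1 (hc0.trans_le hder), ?_, fun x hx => ?_, fun x hx y hy hxy => ?_⟩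
  · rw [lagrangeKernel_eq_inv]
    refine (differentiable_dslope_aeval Q u).diffContOnCl.inv fun x hx => ?_
    rw [closure_ball _ (half_pos hr0).ne'] at hx
    exact norm_pos_iff.1 (hc0.trans_le (hds x hx))
  · rw [lagrangeKernel_eq_inv, Pi.inv_apply, norm_inv]
    exact inv_anti₀ hc0 (hds x hx)
  · have h3 := hexp x hx y hy
    rw [hxy, sub_self, norm_zero] at h3
    have h4 : ‖x - y‖ ≤ 0 := by nlinarith [norm_nonneg (x - y)]
    exact sub_eq_zero.1 (norm_le_zero_iff.1 h4)

/-- Cauchy's estimate for the coefficients. -/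
theorem norm_coeff_succ_lagrangeSeries_le {Q : ℚ[X]} {u : ℂ} {ρ B : ℝ} (hρ : 0 < ρ)
    (hd : DiffContOnCl ℂ (lagrangeKernel Q u) (Metric.ball u ρ))
    (hB : ∀ x ∈ Metric.closedBall u ρ, ‖lagrangeKernel Q u x‖ ≤ B) (n : ℕ) :
    ‖PowerSeries.coeff (n + 1) (lagrangeSeries Q u)‖ ≤ ρ * (‖aeval u Q‖ * B / ρ) ^ (n + 1) := by
  have hd' : DiffContOnCl ℂ (fun x => lagrangeKernel Q u x ^ (n + 1)) (Metric.ball u ρ) :=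
    ⟨hd.differentiableOn.fun_pow _, hd.continuousOn.pow _⟩
  have h := Complex.norm_iteratedDeriv_le_of_forall_mem_sphere_norm_le n hρ hd'
    (C := B ^ (n + 1)) fun z hz => by
      rw [norm_pow]
      exact pow_le_pow_left₀ (norm_nonneg _) (hB z (Metric.sphere_subset_closedBall hz)) _
  have hn : (0 : ℝ) < n.factorial := by exact_mod_cast n.factorial_pos
  have hn1 : ‖(n : ℂ) + 1‖ = (n : ℝ) + 1 := by
    rw [← Nat.cast_succ, Complex.norm_natCast, Nat.cast_succ]
  have hB0 : 0 ≤ B := (norm_nonneg _).trans (hB u (Metric.mem_closedBall_self hρ.le))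
  rw [coeff_succ_lagrangeSeries, norm_mul, norm_div, norm_div, norm_pow, norm_neg, hn1,
    Complex.norm_natCast]
  calc ‖aeval u Q‖ ^ (n + 1) / ((n : ℝ) + 1) *
        (‖iteratedDeriv n (fun x => lagrangeKernel Q u x ^ (n + 1)) u‖ / n.factorial)
      ≤ ‖aeval u Q‖ ^ (n + 1) / 1 * ((n.factorial * B ^ (n + 1) / ρ ^ n) / n.factorial) := by
        gcongr
        linarith [(n.cast_nonneg : (0 : ℝ) ≤ n)]
    _ = ρ * (‖aeval u Q‖ * B / ρ) ^ (n + 1) := by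
        rw [div_pow, mul_pow]
        field_simp
        ring

theorem le_convergenceRadius {f : PowerSeries ℂ} {r C : ℝ} (hr : 0 ≤ r)
    (h : ∀ n, ‖PowerSeries.coeff n f‖ * r ^ n ≤ C) : ENNReal.ofReal r ≤ convergenceRadius f := by
  refine FormalMultilinearSeries.le_radius_of_bound _ C (r := r.toNNReal) fun n => ?_
  rw [FormalMultilinearSeries.ofScalars_norm, Real.coe_toNNReal r hr]
  exact h n

/-! ### Values at `1` -/

/-- The series converges absolutely at `1`, with sum `w`. -/
def HasAbsValueAtOne (f : PowerSeries ℂ) (w : ℂ) : Prop :=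
  Summable (fun n => ‖PowerSeries.coeff n f‖) ∧ HasSum (fun n => PowerSeries.coeff n f) w

theorem HasAbsValueAtOne.add {f g : PowerSeries ℂ} {v w : ℂ} (hf : HasAbsValueAtOne f v)
    (hg : HasAbsValueAtOne g w) : HasAbsValueAtOne (f + g) (v + w) := by
  refine ⟨(hf.1.add hg.1).of_nonneg_of_le (fun _ => norm_nonneg _) fun n => ?_, ?_⟩
  · rw [map_add]; exact norm_add_le _ _
  · simpa using hf.2.add hg.2

/-- Cauchy products are why absolute convergence is carried along: it lets a polynomial identity
between series be evaluated at `1`. -/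
theorem HasAbsValueAtOne.mul {f g : PowerSeries ℂ} {v w : ℂ} (hf : HasAbsValueAtOne f v)
    (hg : HasAbsValueAtOne g w) : HasAbsValueAtOne (f * g) (v * w) := by
  have h := summable_norm_sum_mul_antidiagonal_of_summable_norm hf.1 hg.1
  have h2 := tsum_mul_tsum_eq_tsum_sum_antidiagonal_of_summable_norm hf.1 hg.1
  rw [hf.2.tsum_eq, hg.2.tsum_eq] at h2
  refine ⟨by simpa only [PowerSeries.coeff_mul] using h, ?_⟩
  rw [h2]
  simpa only [PowerSeries.coeff_mul] using h.of_norm.hasSum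

theorem hasAbsValueAtOne_coe (p : ℂ[X]) : HasAbsValueAtOne (p : PowerSeries ℂ) (p.eval 1) := by
  have h0 : ∀ n ∉ Finset.range (p.natDegree + 1), PowerSeries.coeff n (p : PowerSeries ℂ) = 0 :=
    fun n hn => by
      rw [Polynomial.coeff_coe]
      exact coeff_eq_zero_of_natDegree_lt (by simpa using hn)
  refine ⟨summable_of_ne_finset_zero (s := Finset.range (p.natDegree + 1)) fun n hn => by
    rw [h0 n hn, norm_zero], ?_⟩
  have h1 : p.eval 1 = ∑ n ∈ Finset.range (p.natDegree + 1),
      PowerSeries.coeff n (p : PowerSeries ℂ) := by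
    simp [eval_eq_sum_range]
  rw [h1]
  exact hasSum_sum_of_ne_finset_zero h0

theorem hasAbsValueAtOne_C (c : ℂ) : HasAbsValueAtOne (PowerSeries.C c) c := by
  simpa using hasAbsValueAtOne_coe (C c)

theorem HasAbsValueAtOne.pow {f : PowerSeries ℂ} {v : ℂ} (hf : HasAbsValueAtOne f v) (n : ℕ) :
    HasAbsValueAtOne (f ^ n) (v ^ n) := by
  induction n with
  | zero => simpa using hasAbsValueAtOne_C 1
  | succ n ih => rw [pow_succ, pow_succ]; exact ih.mul hf

theorem HasAbsValueAtOne.aeval {f : PowerSeries ℂ} {v : ℂ} (hf : HasAbsValueAtOne f v)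
    (Q : ℚ[X]) : HasAbsValueAtOne (aeval f Q) (aeval v Q) := by
  induction Q using Polynomial.induction_on' with
  | add p q hp hq => rw [map_add, map_add]; exact hp.add hq
  | monomial n a =>
    rw [aeval_monomial, aeval_monomial]
    refine HasAbsValueAtOne.mul ?_ (hf.pow n)
    rw [← RingHom.congr_fun (RingHom.ext_rat ((PowerSeries.C (R := ℂ)).comp (algebraMap ℚ ℂ))
      (algebraMap ℚ (PowerSeries ℂ))) a]
    exact hasAbsValueAtOne_C _

theorem HasAbsValueAtOne.hasValueAt {f : PowerSeries ℂ} {v : ℂ} (hf : HasAbsValueAtOne f v) :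
    HasValueAt f 1 v := by
  simpa [HasValueAt] using hf.2

/-- If the coefficients are small, then the value at `1` is a root of `Q`. -/
theorem exists_root_hasAbsValueAtOne_lagrangeSeries {Q : ℚ[X]} {u : ℂ} {ρ q : ℝ}
    (hu : aeval u (derivative Q) ≠ 0) (hρ : 0 < ρ) (hq0 : 0 ≤ q) (hq : q ≤ 1 / 2)
    (h : ∀ n, ‖PowerSeries.coeff (n + 1) (lagrangeSeries Q u)‖ ≤ ρ * q ^ (n + 1)) :
    ∃ v, HasAbsValueAtOne (lagrangeSeries Q u) v ∧ ‖v - u‖ ≤ ρ ∧ aeval v Q = 0 := by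
  have hgeom : HasSum (fun n => ρ * q ^ (n + 1)) (ρ * (q * (1 - q)⁻¹)) := by
    have := ((hasSum_geometric_of_lt_one hq0 (by linarith)).mul_left q).mul_left ρ
    simpa only [pow_succ'] using this
  have hs1 : Summable fun n => ‖PowerSeries.coeff (n + 1) (lagrangeSeries Q u)‖ :=
    hgeom.summable.of_nonneg_of_le (fun _ => norm_nonneg _) h
  have hs : Summable fun n => ‖PowerSeries.coeff n (lagrangeSeries Q u)‖ :=
    (summable_nat_add_iff 1).1 hs1
  have hv : HasAbsValueAtOne (lagrangeSeries Q u) (∑' n, PowerSeries.coeff n (lagrangeSeries Q u)) :=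
    ⟨hs, hs.of_norm.hasSum⟩
  refine ⟨_, hv, ?_, ?_⟩
  · rw [hs.of_norm.tsum_eq_zero_add, coeff_zero_lagrangeSeries, add_sub_cancel_left]
    refine (norm_tsum_le_tsum_norm hs1).trans ((hs1.tsum_le_tsum h hgeom.summable).trans ?_)
    rw [hgeom.tsum_eq]
    -- This is where `q ≤ 1 / 2` keeps the value within `ρ` of `u`.
    have h1 : q * (1 - q)⁻¹ ≤ 1 := by
      rw [← div_eq_mul_inv, div_le_one (by linarith)]; linarith
    nlinarith
  -- Evaluate `Q(Φ_u) = (1 - z) Q(u)` at `z = 1`, where the right side vanishes.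
  · have h1 := hv.aeval Q
    rw [aeval_lagrangeSeries hu] at h1
    have h2 := hasAbsValueAtOne_coe ((1 - X) * C (aeval u Q))
    rw [eval_mul, eval_sub, eval_one, eval_X, sub_self, zero_mul, Polynomial.coe_mul,
      Polynomial.coe_sub, Polynomial.coe_one, Polynomial.coe_X, Polynomial.coe_C] at h2
    exact h1.2.unique h2.2

/-! ### The `G`-function property and the values `α` -/

theorem isGFunction_lagrangeSeries {Q : ℚ[X]} {u : ℂ} (hK : u ∈ GaussField)
    (hu : aeval u (derivative Q) ≠ 0) : IsGFunction (lagrangeSeries Q u) := by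
  have hcoeff := hasCoeffsIn_lagrangeSeries hK hu
  refine ⟨fun n => (isIntegral_of_mem_gaussField (hcoeff n)).isAlgebraic, ?_,
    satisfiesLinearODE_lagrangeSeries hK hu⟩
  obtain ⟨M, hM, hMS⟩ := exists_natCast_pow_mul_coeff_lagrangeSeries_mem hK hu
  -- Only a bound for this fixed `u` is needed, so the base point is `u` itself.
  obtain ⟨ρ, hρ, B, hB, h⟩ := exists_lagrangeKernel_bound hu
  obtain ⟨-, hd, hbd, -⟩ := h u (by rwa [sub_self, norm_zero])
  have hcb := norm_coeff_succ_lagrangeSeries_le hρ hd hbd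
  set q := ‖aeval u Q‖ * B / ρ with hq
  have hq0 : 0 ≤ q := by positivity
  have hM1 : (1 : ℝ) ≤ M := by exact_mod_cast Nat.one_le_iff_ne_zero.2 hM
  -- One constant dominating every bound; `A ≥ 1` because `M ≥ 1`.
  set A := M + ρ + q + ‖u‖ with hA
  have hA1 : 1 ≤ A := by linarith [norm_nonneg u]
  have hAM : M ≤ A := by linarith [norm_nonneg u]
  have hbound : ∀ n, ‖PowerSeries.coeff n (lagrangeSeries Q u)‖ ≤ A ^ (n + 1) := fun n => by
    cases n with
    | zero => rw [coeff_zero_lagrangeSeries, zero_add, pow_one]; linarith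
    | succ n =>
      calc _ ≤ ρ * q ^ (n + 1) := hcb n
        _ ≤ A * A ^ (n + 1) := by
          gcongr <;> linarith [norm_nonneg u]
        _ = A ^ (n + 1 + 1) := by ring
  refine ⟨A, by linarith, fun n b hb => ?_, fun n => (M : ℤ) ^ (n + 1), fun n => ⟨?_, ?_, ?_⟩⟩
  · rw [norm_eq_of_isConjRoot_of_mem_gaussField (hcoeff n) hb]
    exact hbound n
  · exact pow_ne_zero _ (by exact_mod_cast hM)
  · push_cast
    rw [abs_of_nonneg (by positivity)]
    exact pow_le_pow_left₀ (by positivity) hAM _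
  · intro m hm
    have h1 : (((M : ℤ) ^ (n + 1) : ℤ) : ℂ) * PowerSeries.coeff m (lagrangeSeries Q u)
        = (M : ℂ) ^ (n - m) * ((M : ℂ) ^ (m + 1) * PowerSeries.coeff m (lagrangeSeries Q u)) := by
      rw [← mul_assoc, ← pow_add, show n - m + (m + 1) = n + 1 by lia]
      push_cast
      rfl
    rw [h1]
    exact (mem_gaussIntegers.1 (mul_mem (pow_mem (natCast_mem _ _) _) (hMS m))).1

/-- Near a simple root `α` of `Q`, the series has large radius of convergence and value `α`
at `1`. -/
theorem exists_lagrangeSeries_near_root {α : ℂ} {Q : ℚ[X]} (hα : aeval α Q = 0)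
    (hα' : aeval α (derivative Q) ≠ 0) {R : ℝ} (hR : 1 ≤ R) :
    ∃ ε : ℝ, 0 < ε ∧ ∀ u : ℂ, ‖u - α‖ < ε → aeval u (derivative Q) ≠ 0 ∧
      ENNReal.ofReal R < convergenceRadius (lagrangeSeries Q u) ∧
      HasValueAt (lagrangeSeries Q u) 1 α := by
  obtain ⟨ρ, hρ, B, hB, h⟩ := exists_lagrangeKernel_bound hα'
  -- The threshold gives `q (R + 1) ≤ 1 / 2`: bounded terms at radius `R + 1 > R`, and also the `q ≤
  -- 1 / 2` needed for the value at `1`.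
  have hlim : ∀ᶠ u : ℂ in nhds α, ‖aeval u Q‖ * B / ρ < 1 / (2 * (R + 1)) := by
    have hc : Continuous fun u : ℂ => ‖aeval u Q‖ * B / ρ :=
      ((Q.continuous_aeval).norm.mul_const B).div_const ρ
    refine hc.continuousAt.eventually (gt_mem_nhds ?_)
    beta_reduce
    rw [hα, norm_zero, zero_mul, zero_div]
    positivity
  obtain ⟨δ, hδ, hlim⟩ := Metric.eventually_nhds_iff.1 hlim
  refine ⟨min δ ρ, lt_min hδ hρ, fun u hu => ?_⟩
  obtain ⟨hu', hd, hbd, hinj⟩ := h u (hu.trans_le (min_le_right _ _))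
  have hq := hlim (show dist u α < δ by
    rw [dist_eq_norm]; exact hu.trans_le (min_le_left _ _))
  have hcb := norm_coeff_succ_lagrangeSeries_le hρ hd hbd
  set q := ‖aeval u Q‖ * B / ρ with hqdef
  have hq0 : 0 ≤ q := by positivity
  have hqR : q * (R + 1) ≤ 1 / 2 := by
    rw [lt_div_iff₀ (by positivity)] at hq
    linarith
  refine ⟨hu', ?_, ?_⟩
  · refine lt_of_lt_of_le (ENNReal.ofReal_lt_ofReal_iff_of_nonneg (by linarith) |>.2
      (lt_add_one R)) (le_convergenceRadius (C := ‖u‖ + ρ) (by linarith) fun n => ?_)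
    cases n with
    | zero => rw [coeff_zero_lagrangeSeries, pow_zero, mul_one]; linarith
    | succ n =>
      calc _ ≤ ρ * q ^ (n + 1) * (R + 1) ^ (n + 1) := by
            gcongr
            exact hcb n
        _ = ρ * (q * (R + 1)) ^ (n + 1) := by rw [mul_pow, mul_assoc]
        _ ≤ ρ * 1 := by
            gcongr
            exact pow_le_one₀ (by positivity) (by linarith)
        _ ≤ ‖u‖ + ρ := by linarith [norm_nonneg u]
  · obtain ⟨v, hv, hvu, hv0⟩ := exists_root_hasAbsValueAtOne_lagrangeSeries hu' hρ hq0
      (by nlinarith) hcb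
    -- Both roots of `Q` lie in the closed `ρ`-disc about `u`, where `Q` is injective.
    have hvα : v = α := hinj v (by rwa [Metric.mem_closedBall, dist_eq_norm]) α (by
      rw [Metric.mem_closedBall, dist_comm, dist_eq_norm]
      exact (hu.trans_le (min_le_right _ _)).le) (hv0.trans hα.symm)
    exact hvα ▸ hv.hasValueAt

theorem aeval_derivative_ne_zero_of_rootMultiplicity_eq_one {α : ℂ} {Q : ℚ[X]} (hQ : Q ≠ 0)
    (h : (Q.map (algebraMap ℚ ℂ)).rootMultiplicity α = 1) :
    aeval α Q = 0 ∧ aeval α (derivative Q) ≠ 0 := by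
  have hQ' : Q.map (algebraMap ℚ ℂ) ≠ 0 := Polynomial.map_ne_zero hQ
  have hroot : (Q.map (algebraMap ℚ ℂ)).IsRoot α :=
    (rootMultiplicity_pos hQ').1 (by rw [h]; exact one_pos)
  refine ⟨by rwa [IsRoot, eval_map_algebraMap] at hroot, fun h0 => ?_⟩
  have h1 : 1 < (Q.map (algebraMap ℚ ℂ)).rootMultiplicity α :=
    (one_lt_rootMultiplicity_iff_isRoot hQ').2 ⟨hroot, by
      rw [derivative_map, IsRoot, eval_map_algebraMap, h0]⟩
  lia

theorem mem_GValues_of_isAlgebraic {ξ : ℂ} (hξ : IsAlgebraic ℚ ξ) : ξ ∈ GValues GaussField := by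
  intro R hR
  have hder : aeval ξ (derivative (minpoly ℚ ξ)) ≠ 0 :=
    (minpoly.irreducible hξ.isIntegral).separable.aeval_derivative_ne_zero (minpoly.aeval ℚ ξ)
  obtain ⟨ε, hε, h⟩ := exists_lagrangeSeries_near_root (minpoly.aeval ℚ ξ) hder hR
  obtain ⟨u, huK, hu⟩ := exists_gaussField_near ξ hε
  obtain ⟨h1, h2, h3⟩ := h u hu
  exact ⟨_, isGFunction_lagrangeSeries huK h1, hasCoeffsIn_lagrangeSeries huK h1, h2, h3⟩

theorem mainTheorem5 :
    (∀ (α : ℂ) (Q : ℚ[X]), Q ≠ 0 →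
      (Q.map (algebraMap ℚ ℂ)).rootMultiplicity α = 1 →
        (∀ u ∈ GaussField, aeval u (derivative Q) ≠ 0 →
          IsGFunction (lagrangeSeries Q u) ∧
          HasCoeffsIn GaussField (lagrangeSeries Q u) ∧
          aeval (lagrangeSeries Q u) Q = (1 - PowerSeries.X) * PowerSeries.C (aeval u Q)) ∧
        (∀ R : ℝ, 1 ≤ R → ∃ ε : ℝ, 0 < ε ∧ ∀ u ∈ GaussField, ‖u - α‖ < ε →
          aeval u (derivative Q) ≠ 0 ∧
          ENNReal.ofReal R < convergenceRadius (lagrangeSeries Q u) ∧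
          HasValueAt (lagrangeSeries Q u) 1 α ∧
          α ∈ GValuesOfRadius R GaussField)) ∧
    {ξ : ℂ | IsAlgebraic ℚ ξ} ⊆ GValues GaussField := by
  refine ⟨fun α Q hQ hroot => ⟨fun u hK hu => ⟨isGFunction_lagrangeSeries hK hu,
    hasCoeffsIn_lagrangeSeries hK hu, aeval_lagrangeSeries hu⟩, fun R hR => ?_⟩,
    fun ξ hξ => mem_GValues_of_isAlgebraic hξ⟩
  obtain ⟨hα, hα'⟩ := aeval_derivative_ne_zero_of_rootMultiplicity_eq_one hQ hroot
  obtain ⟨ε, hε, h⟩ := exists_lagrangeSeries_near_root hα hα' hR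
  refine ⟨ε, hε, fun u hK hu => ?_⟩
  obtain ⟨h1, h2, h3⟩ := h u hu
  exact ⟨h1, h2, h3,
    ⟨_, isGFunction_lagrangeSeries hK h1, hasCoeffsIn_lagrangeSeries hK h1, h2, h3⟩⟩
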